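/- Let $A$ and $B$ be unital complex C*-algebras. A state of a unital C*-algebra is a positive linear functional $\varphi$ with $\varphi(1)=1$, and the numerical radius of an element $x$ is $\nu(x)=\sup\{|\varphi(x)| : \varphi \text{ a state}\}$. Let $T\colon A\to B$ be a surjective linear map (not assumed to be continuous) with $T1=1$ and $\nu(Tx)=\nu(x)$ for all $x\in A$. Then $T$ is a Jordan *-isomorphism, that is, $T$ is bijective, $T(x\circ y)=Tx\circ Ty$ for all $x,y\in A$, where $x\circ y=\frac12(xy+yx)$, and $T(x^*)=(Tx)^*$ for all $x\in A$. -/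

import Mathlib

open scoped ComplexOrder

/-- A state of a unital C*-algebra: a linear functional `φ` that is positive,
`φ (a* a) ≥ 0` for all `a` (the order of `ℂ`: real and nonnegative), and normalised, `φ 1 = 1`. -/
structure IsCStarState {A : Type*} [CStarAlgebra A] (φ : A →ₗ[ℂ] ℂ) : Prop where
  nonneg : ∀ a : A, 0 ≤ φ (star a * a)
  map_one : φ 1 = 1

/-- States are contractive: `|φ(x)| ≤ ‖x‖`. -/
theorem IsCStarState.norm_apply_le {A : Type*} [CStarAlgebra A] {φ : A →ₗ[ℂ] ℂ}
    (hφ : IsCStarState φ) (x : A) : ‖φ x‖ ≤ ‖x‖ := by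
  letI : PartialOrder A := CStarAlgebra.spectralOrder A
  haveI : StarOrderedRing A := CStarAlgebra.spectralOrderedRing A
  let f : A →ₚ[ℂ] ℂ := PositiveLinearMap.mk₀ φ (by
    intro a ha
    obtain ⟨b, rfl⟩ := CStarAlgebra.nonneg_iff_eq_star_mul_self.mp ha
    exact hφ.nonneg b)
  have hf : ∀ a, f a = φ a := fun a => rfl
  have h1 : ‖f.toPreGNS (1 : A)‖ = 1 := by
    simp [PositiveLinearMap.preGNS_norm_def, hf, hφ.map_one]
  have h2 : inner ℂ (f.toPreGNS (1 : A)) (f.toPreGNS x) = φ x := by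
    simp [PositiveLinearMap.preGNS_inner_def, hf]
  have h3 : ‖f.toPreGNS x‖ ≤ ‖x‖ := by
    have h4 : φ (star x * x) ≤ φ (algebraMap ℝ A (‖star x * x‖)) :=
      f.monotone' (IsSelfAdjoint.le_algebraMap_norm_self (IsSelfAdjoint.star_mul_self x))
    have h5 : φ (algebraMap ℝ A (‖star x * x‖)) = ((‖x‖ * ‖x‖ : ℝ) : ℂ) := by
      rw [CStarRing.norm_star_mul_self, IsScalarTower.algebraMap_apply ℝ ℂ A,
        Algebra.algebraMap_eq_smul_one, map_smul, hφ.map_one]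
      simp
    rw [h5] at h4
    have h6 := (Complex.le_def.mp h4).1
    have h7 : ((‖f.toPreGNS x‖ ^ 2 : ℝ) : ℂ) = φ (star x * x) := by
      have := f.preGNS_norm_sq (f.toPreGNS x)
      simpa [hf] using this
    rw [← h7, Complex.ofReal_re, Complex.ofReal_re] at h6
    nlinarith [norm_nonneg x, norm_nonneg (f.toPreGNS x)]
  calc ‖φ x‖ = ‖inner ℂ (f.toPreGNS (1 : A)) (f.toPreGNS x)‖ := by rw [h2]
    _ ≤ ‖f.toPreGNS (1 : A)‖ * ‖f.toPreGNS x‖ := norm_inner_le_norm _ _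
    _ ≤ ‖x‖ := by rw [h1, one_mul]; exact h3

/-- The supremum in the numerical radius is that of a bounded set. -/
theorem bddAbove_norm_states {A : Type*} [CStarAlgebra A] (x : A) :
    BddAbove {r : ℝ | ∃ φ : A →ₗ[ℂ] ℂ, IsCStarState φ ∧ r = ‖φ x‖} := by
  refine ⟨‖x‖, ?_⟩
  rintro r ⟨φ, hφ, rfl⟩
  exact hφ.norm_apply_le x

/-- The numerical radius `ν(x) = sup { |φ(x)| : φ a state of A }`. The set is bounded above, see
`bddAbove_norm_states`. It is empty only if `A` is the zero algebra, where `ν(0) = 0`. -/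
noncomputable def numericalRadius {A : Type*} [CStarAlgebra A] (x : A) : ℝ :=
  sSup {r : ℝ | ∃ φ : A →ₗ[ℂ] ℂ, IsCStarState φ ∧ r = ‖φ x‖}

/-- The Jordan product `x ∘ y = (xy + yx) / 2`. -/
noncomputable def jordanProduct {A : Type*} [CStarAlgebra A] (x y : A) : A :=
  (2⁻¹ : ℂ) • (x * y + y * x)

/-- A Jordan *-isomorphism: a bijective linear map that preserves the Jordan product and the
involution. -/
structure IsJordanStarIsomorphism {A B : Type*} [CStarAlgebra A] [CStarAlgebra B]
    (T : A →ₗ[ℂ] B) : Prop where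
  bijective : Function.Bijective T
  map_jordanProduct : ∀ x y : A, T (jordanProduct x y) = jordanProduct (T x) (T y)
  map_star : ∀ x : A, T (star x) = star (T x)

/-! A unital functional bounded by the norm is a state, and `numericalRadius` is at most the norm,
so composing a state with `T` gives a state, without continuity of `T`. States detect positivity, so
`T` is positive. They also separate points, so `T` is injective; its inverse preserves the numerical
radius too, and `T` is a unital order isomorphism. Kadison's inequality for `T` and its inverse then
gives `T (h * h) = T h * T h` for self-adjoint `h`, and polarisation gives the Jordan product. -/

/-! ### States, positivity and the numerical radius -/

section States

variable {A : Type*} [CStarAlgebra A]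

/-- A unital contractive functional on a C*-algebra is a state. -/
theorem isCStarState_of_norm_le {φ : A →ₗ[ℂ] ℂ} (h1 : φ 1 = 1) (hφ : ∀ x, ‖φ x‖ ≤ ‖x‖) :
    IsCStarState φ := by
  refine ⟨fun a => ?_, h1⟩
  let _ : PartialOrder A := CStarAlgebra.spectralOrder A
  have _ : StarOrderedRing A := CStarAlgebra.spectralOrderedRing A
  have _ : Nontrivial A := ⟨1, 0, fun h => by simp [h] at h1⟩
  have hh : 0 ≤ star a * a := star_mul_self_nonneg a
  generalize star a * a = h at hh
  have hsa : star h = h := hh.star_eq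
  have him : (φ h).im = 0 := by
    -- Moving from `1` to `1 + ith` changes the norm only to second order in `t`, but the real part
    -- of `φ` to first order unless `φ h` is real.
    have key : ∀ t : ℝ, (1 - t * (φ h).im) ^ 2 ≤ 1 + t ^ 2 * ‖h‖ ^ 2 := by
      intro t
      set z : A := 1 + (Complex.I * t) • h with hz
      have hzz : star z * z = 1 + ((t : ℂ) ^ 2) • (h * h) := by
        simp only [hz, star_add, star_one, star_smul, hsa, add_mul, mul_add, one_mul, mul_one,
          smul_mul_smul_comm, Complex.star_def, map_mul, Complex.conj_I, Complex.conj_ofReal]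
        have : (-Complex.I * t * (Complex.I * t) : ℂ) = (t : ℂ) ^ 2 := by
          linear_combination (-(t : ℂ) ^ 2) * Complex.I_mul_I
        rw [this]
        module
      have h2 : ‖z‖ ^ 2 ≤ 1 + t ^ 2 * ‖h‖ ^ 2 := by
        rw [sq, ← CStarRing.norm_star_mul_self, hzz]
        refine (norm_add_le _ _).trans ?_
        rw [norm_one, norm_smul]
        gcongr
        · simp
        · rw [sq]; exact norm_mul_le _ _
      have h3 : |(φ z).re| ≤ ‖z‖ := (Complex.abs_re_le_norm _).trans (hφ z)
      have h4 : (φ z).re = 1 - t * (φ h).im := by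
        simp [hz, h1, sub_eq_add_neg]
      rw [h4] at h3
      calc (1 - t * (φ h).im) ^ 2 = |1 - t * (φ h).im| ^ 2 := (sq_abs _).symm
        _ ≤ ‖z‖ ^ 2 := by gcongr
        _ ≤ _ := h2
    by_contra hq
    have hpos : 0 < ‖h‖ ^ 2 + 1 := by positivity
    have := key (-(φ h).im / (‖h‖ ^ 2 + 1))
    have h5 : 0 < (φ h).im ^ 2 := by positivity
    have e : 1 + (-(φ h).im / (‖h‖ ^ 2 + 1)) ^ 2 * ‖h‖ ^ 2
        - (1 - -(φ h).im / (‖h‖ ^ 2 + 1) * (φ h).im) ^ 2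
        = -((φ h).im ^ 2 * ((‖h‖ ^ 2 + 2) + (φ h).im ^ 2)) / (‖h‖ ^ 2 + 1) ^ 2 := by
      field_simp
      ring
    have : -((φ h).im ^ 2 * ((‖h‖ ^ 2 + 2) + (φ h).im ^ 2)) / (‖h‖ ^ 2 + 1) ^ 2 < 0 := by
      apply div_neg_of_neg_of_pos _ (by positivity)
      rw [neg_lt_zero]
      positivity
    linarith
  have hre : 0 ≤ (φ h).re := by
    have hle : h ≤ algebraMap ℝ A ‖h‖ := IsSelfAdjoint.le_algebraMap_norm_self hsa
    have h2 : ‖algebraMap ℝ A ‖h‖ - h‖ ≤ ‖h‖ := by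
      calc ‖algebraMap ℝ A ‖h‖ - h‖ ≤ ‖algebraMap ℝ A ‖h‖‖ :=
            CStarAlgebra.norm_le_norm_of_nonneg_of_le (sub_nonneg.2 hle) (sub_le_self _ hh)
        _ = ‖h‖ := by rw [norm_algebraMap']; simp
    have h3 := (Complex.re_le_norm _).trans ((hφ (algebraMap ℝ A ‖h‖ - h)).trans h2)
    have h4 : φ (algebraMap ℝ A ‖h‖) = (‖h‖ : ℝ) := by
      rw [IsScalarTower.algebraMap_apply ℝ ℂ A, Algebra.algebraMap_eq_smul_one, map_smul, h1]
      simp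
    rw [map_sub, h4, Complex.sub_re, Complex.ofReal_re] at h3
    linarith
  exact Complex.le_def.2 ⟨by simpa using hre, by simpa using him.symm⟩

theorem IsCStarState.map_nonneg [PartialOrder A] [StarOrderedRing A] {φ : A →ₗ[ℂ] ℂ}
    (hφ : IsCStarState φ) {a : A} (ha : 0 ≤ a) : 0 ≤ φ a := by
  obtain ⟨b, rfl⟩ := CStarAlgebra.nonneg_iff_eq_star_mul_self.mp ha
  exact hφ.nonneg b

theorem IsCStarState.im_eq_zero {φ : A →ₗ[ℂ] ℂ} (hφ : IsCStarState φ) {a : A}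
    (ha : IsSelfAdjoint a) : (φ a).im = 0 := by
  let _ : PartialOrder A := CStarAlgebra.spectralOrder A
  have _ : StarOrderedRing A := CStarAlgebra.spectralOrderedRing A
  have h := hφ.map_nonneg (sub_nonneg.2 ha.le_algebraMap_norm_self)
  rw [IsScalarTower.algebraMap_apply ℝ ℂ A, Algebra.algebraMap_eq_smul_one, map_sub, map_smul,
    hφ.map_one] at h
  simpa using (Complex.le_def.1 h).2

/-- A self-adjoint element that is not positive takes a negative value at some state. -/
theorem exists_isCStarState_re_neg [PartialOrder A] [StarOrderedRing A] {a : A}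
    (ha : IsSelfAdjoint a) (hn : ¬ 0 ≤ a) :
    ∃ φ : A →ₗ[ℂ] ℂ, IsCStarState φ ∧ (φ a).re < 0 := by
  have hconv : Convex ℝ {x : A | 0 ≤ x} := by
    intro x hx y hy s t hs ht _
    exact add_nonneg (smul_nonneg hs hx) (smul_nonneg ht hy)
  have hclosed : IsClosed {x : A | 0 ≤ x} := isClosed_Ici
  obtain ⟨f, u, hfa, hfu⟩ := geometric_hahn_banach_point_closed hconv hclosed hn
  have hu : u < 0 := by simpa using hfu 0 le_rfl
  have hpos : ∀ x : A, 0 ≤ x → 0 ≤ f x := by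
    intro x hx
    by_contra! hlt
    -- This multiple of `x` stays in the cone, yet `f` takes the value `u` there.
    have h1 : 0 ≤ u / f x := (div_pos_of_neg_of_neg hu hlt).le
    have h2 := hfu ((u / f x) • x) (smul_nonneg h1 hx)
    rw [map_smul, smul_eq_mul, div_mul_cancel₀ _ hlt.ne] at h2
    exact lt_irrefl _ h2
  have hone : 0 < f 1 := by
    have h1 := hpos _ (sub_nonneg.2 ha.neg.le_algebraMap_norm_self)
    rw [map_sub, map_neg, Algebra.algebraMap_eq_smul_one, map_smul, smul_eq_mul] at h1
    by_contra! h2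
    nlinarith [norm_nonneg (-a)]
  -- Passing through the real part makes the complex extension real on self-adjoint elements.
  let g : Module.Dual ℝ A :=
    (f 1)⁻¹ • (f.toLinearMap ∘ₗ (selfAdjoint.submodule ℝ A).subtype ∘ₗ realPart)
  have hg : ∀ x : A, IsSelfAdjoint x → g x = (f 1)⁻¹ * f x := by
    intro x hx
    change (f 1)⁻¹ * f (realPart x : A) = _
    rw [hx.coe_realPart]
  have hgI : ∀ x : A, IsSelfAdjoint x → g (Complex.I • x) = 0 := by
    intro x hx
    change (f 1)⁻¹ * f (realPart (Complex.I • x) : A) = _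
    simp [realPart_I_smul, hx.imaginaryPart]
  have hext : ∀ x : A, IsSelfAdjoint x →
      (g.extendRCLike : Module.Dual ℂ A) x = ((f 1)⁻¹ * f x : ℝ) := by
    intro x hx
    rw [Module.Dual.extendRCLike_apply, hg x hx]
    have := hgI x hx
    simp_all
  refine ⟨g.extendRCLike, ⟨fun b => ?_, ?_⟩, ?_⟩
  · rw [hext _ (.star_mul_self b)]
    have := hpos _ (star_mul_self_nonneg b)
    have h2 : 0 ≤ (f 1)⁻¹ * f (star b * b) := by positivity
    exact_mod_cast h2
  · rw [hext _ (.one A), inv_mul_cancel₀ hone.ne']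
    simp
  · rw [hext _ ha, Complex.ofReal_re]
    exact mul_neg_of_pos_of_neg (inv_pos.2 hone) (hfa.trans hu)

theorem IsSelfAdjoint.eq_zero_of_states {a : A} (ha : IsSelfAdjoint a)
    (h : ∀ φ : A →ₗ[ℂ] ℂ, IsCStarState φ → φ a = 0) : a = 0 := by
  let _ : PartialOrder A := CStarAlgebra.spectralOrder A
  have _ : StarOrderedRing A := CStarAlgebra.spectralOrderedRing A
  apply le_antisymm
  · by_contra hn
    obtain ⟨φ, hφ, hlt⟩ := exists_isCStarState_re_neg ha.neg (fun h' => hn (neg_nonneg.1 h'))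
    simp [h φ hφ] at hlt
  · by_contra hn
    obtain ⟨φ, hφ, hlt⟩ := exists_isCStarState_re_neg ha hn
    simp [h φ hφ] at hlt

theorem map_eq_map_realPart_add_I_mul_map_imaginaryPart (φ : A →ₗ[ℂ] ℂ) (x : A) :
    φ x = φ (realPart x) + Complex.I * φ (imaginaryPart x) := by
  conv_lhs => rw [← realPart_add_I_smul_imaginaryPart x]
  simp

theorem IsCStarState.re_apply {φ : A →ₗ[ℂ] ℂ} (hφ : IsCStarState φ) (x : A) :
    φ (realPart x) = (φ x).re := by
  have h := map_eq_map_realPart_add_I_mul_map_imaginaryPart φ x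
  apply Complex.ext <;> simp [h, hφ.im_eq_zero (realPart x).2, hφ.im_eq_zero (imaginaryPart x).2]

theorem IsCStarState.im_apply {φ : A →ₗ[ℂ] ℂ} (hφ : IsCStarState φ) (x : A) :
    φ (imaginaryPart x) = (φ x).im := by
  have h := map_eq_map_realPart_add_I_mul_map_imaginaryPart φ x
  apply Complex.ext <;> simp [h, hφ.im_eq_zero (realPart x).2, hφ.im_eq_zero (imaginaryPart x).2]

/-- States separate the points of a C*-algebra. -/
theorem eq_zero_of_states {a : A} (h : ∀ φ : A →ₗ[ℂ] ℂ, IsCStarState φ → φ a = 0) : a = 0 := by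
  rw [← realPart_add_I_smul_imaginaryPart a,
    IsSelfAdjoint.eq_zero_of_states (realPart a).2 fun φ hφ => by simp [hφ.re_apply, h φ hφ],
    IsSelfAdjoint.eq_zero_of_states (imaginaryPart a).2 fun φ hφ => by simp [hφ.im_apply, h φ hφ]]
  simp

theorem isSelfAdjoint_of_states {a : A}
    (h : ∀ φ : A →ₗ[ℂ] ℂ, IsCStarState φ → (φ a).im = 0) : IsSelfAdjoint a := by
  rw [← realPart_add_I_smul_imaginaryPart a,
    IsSelfAdjoint.eq_zero_of_states (imaginaryPart a).2 fun φ hφ => by simp [hφ.im_apply, h φ hφ]]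
  simp

theorem nonneg_of_states [PartialOrder A] [StarOrderedRing A] {a : A}
    (h : ∀ φ : A →ₗ[ℂ] ℂ, IsCStarState φ → 0 ≤ φ a) : 0 ≤ a := by
  by_contra hn
  have ha := isSelfAdjoint_of_states fun φ hφ => by simpa using (Complex.le_def.1 (h φ hφ)).2.symm
  obtain ⟨φ, hφ, hlt⟩ := exists_isCStarState_re_neg ha hn
  exact hlt.not_ge (Complex.le_def.1 (h φ hφ)).1

theorem IsCStarState.norm_apply_le_numericalRadius {φ : A →ₗ[ℂ] ℂ} (hφ : IsCStarState φ)
    (x : A) : ‖φ x‖ ≤ numericalRadius x :=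
  le_csSup (bddAbove_norm_states x) ⟨φ, hφ, rfl⟩

theorem numericalRadius_le_norm (x : A) : numericalRadius x ≤ ‖x‖ := by
  apply Real.sSup_le _ (norm_nonneg x)
  rintro r ⟨φ, hφ, rfl⟩
  exact hφ.norm_apply_le x

theorem eq_zero_of_numericalRadius {x : A} (h : numericalRadius x = 0) : x = 0 :=
  eq_zero_of_states fun _ hφ => norm_le_zero_iff.1 (h ▸ hφ.norm_apply_le_numericalRadius x)

end States

/-! ### Kadison's inequality via Bernstein polynomials -/

section Kadison

open Polynomial Filter Topology

theorem aeval_bernsteinPolynomial_nonneg {A : Type*} [CStarAlgebra A] [PartialOrder A]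
    [StarOrderedRing A] {h : A} (h0 : 0 ≤ h) (h1 : h ≤ 1) (n ν : ℕ) :
    0 ≤ aeval h (bernsteinPolynomial ℝ n ν) := by
  have h2 : 0 ≤ 1 - h := sub_nonneg.2 h1
  have hc : Commute h (1 - h) := (Commute.one_right h).sub_right (Commute.refl h)
  have e : aeval h (bernsteinPolynomial ℝ n ν)
      = (n.choose ν : ℝ) • (h ^ ν * (1 - h) ^ (n - ν)) := by
    simp [bernsteinPolynomial, Algebra.smul_def, mul_assoc]
  rw [e]
  exact smul_nonneg (Nat.cast_nonneg _)
    ((hc.pow_pow _ _).mul_nonneg (CStarAlgebra.pow_nonneg h0 _) (CStarAlgebra.pow_nonneg h2 _))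

variable {A B : Type*} [CStarAlgebra A] [CStarAlgebra B] [PartialOrder A] [StarOrderedRing A]
  [PartialOrder B] [StarOrderedRing B]

/-- The positive elements `T (b ν)` sum to `1`: they form an operator-valued binomial distribution
with mean `n • T h`. The inequality says that its variance is nonnegative. -/
theorem bernstein_kadison_inequality (T : A →ₗ[ℂ] B) (hT1 : T 1 = 1)
    (hT : ∀ a, 0 ≤ a → 0 ≤ T a) {h : A} (h0 : 0 ≤ h) (h1 : h ≤ 1) (n : ℕ) :
    0 ≤ ((n : ℝ) * (n - 1)) • T (h * h) + (n : ℝ) • T h - ((n : ℝ) ^ 2) • (T h * T h) := by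
  set b : ℕ → A := fun ν => aeval h (bernsteinPolynomial ℝ n ν) with hb
  have hb0 : ∀ ν, 0 ≤ b ν := fun ν => aeval_bernsteinPolynomial_nonneg h0 h1 n ν
  let L : A →ₗ[ℝ] B := T.restrictScalars ℝ
  have hL : ∀ a, L a = T a := fun _ => rfl
  have s0 : ∑ ν ∈ Finset.range (n + 1), L (b ν) = 1 := by
    rw [← map_sum, hb, ← map_sum, bernsteinPolynomial.sum, map_one, hL, hT1]
  have s1 : ∑ ν ∈ Finset.range (n + 1), (ν : ℝ) • L (b ν) = (n : ℝ) • T h := by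
    have := congrArg (fun p => L (aeval h p)) (bernsteinPolynomial.sum_smul ℝ n)
    simp only [map_sum, ← Nat.cast_smul_eq_nsmul ℝ, map_smul, aeval_X] at this
    exact this
  have s2 : ∑ ν ∈ Finset.range (n + 1), ((ν : ℝ) ^ 2) • L (b ν)
      = ((n : ℝ) * (n - 1)) • T (h * h) + (n : ℝ) • T h := by
    have key := congrArg (fun p => L (aeval h p)) (bernsteinPolynomial.sum_mul_smul ℝ n)
    -- The truncated subtraction at `m = 0` is harmless, as the factor `m` vanishes.
    have hcast : ∀ m : ℕ, ((m * (m - 1) : ℕ) : ℝ) = (m : ℝ) * (m - 1) := by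
      intro m
      cases m <;> simp
    simp only [map_sum, map_smul, map_pow, aeval_X, ← Nat.cast_smul_eq_nsmul ℝ, hcast] at key
    rw [sq, hL] at key
    rw [← key, ← s1, ← Finset.sum_add_distrib]
    refine Finset.sum_congr rfl fun ν _ => ?_
    rw [← add_smul]
    congr 1
    ring
  set S : B := (n : ℝ) • T h with hS
  have hSsa : IsSelfAdjoint S := (IsSelfAdjoint.all _).smul (IsSelfAdjoint.of_nonneg (hT h h0))
  have hsum : 0 ≤ ∑ ν ∈ Finset.range (n + 1),
      ((ν : ℝ) • (1 : B) - S) * L (b ν) * ((ν : ℝ) • (1 : B) - S) := by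
    refine Finset.sum_nonneg fun ν _ => ?_
    have : IsSelfAdjoint ((ν : ℝ) • (1 : B) - S) :=
      ((IsSelfAdjoint.all _).smul (IsSelfAdjoint.one B)).sub hSsa
    exact this.conjugate_nonneg (hT _ (hb0 ν))
  have e : ∀ ν : ℕ, ((ν : ℝ) • (1 : B) - S) * L (b ν) * ((ν : ℝ) • (1 : B) - S)
      = ((ν : ℝ) ^ 2) • L (b ν) - ((ν : ℝ) • L (b ν)) * S - S * ((ν : ℝ) • L (b ν))
        + S * L (b ν) * S := by
    intro ν
    simp only [sub_mul, mul_sub, smul_mul_assoc, mul_smul_comm, one_mul, mul_one]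
    rw [sq, mul_smul, smul_sub]
    abel
  simp only [e, Finset.sum_add_distrib, Finset.sum_sub_distrib, ← Finset.sum_mul,
    ← Finset.mul_sum, s0, s1, s2] at hsum
  convert hsum using 1
  have : ((n : ℝ) ^ 2) • (T h * T h) = S * S := by
    rw [hS, smul_mul_smul_comm, sq]
  rw [this, mul_one]
  abel

/-- Kadison's inequality: a unital positive map satisfies `T(h)² ≤ T(h²)` for `0 ≤ h ≤ 1`. -/
theorem kadison_inequality (T : A →ₗ[ℂ] B) (hT1 : T 1 = 1)
    (hT : ∀ a, 0 ≤ a → 0 ≤ T a) {h : A} (h0 : 0 ≤ h) (h1 : h ≤ 1) :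
    T h * T h ≤ T (h * h) := by
  -- This is the Bernstein inequality of degree `n + 1` divided by `(n + 1) ^ 2`.
  have hlim : Tendsto (fun n : ℕ => T (h * h) - T h * T h
      + (1 / ((n : ℝ) + 1)) • (T h - T (h * h))) atTop (𝓝 (T (h * h) - T h * T h)) := by
    simpa using (tendsto_one_div_add_atTop_nhds_zero_nat (𝕜 := ℝ)).smul_const
      (T h - T (h * h)) |>.const_add (T (h * h) - T h * T h)
  refine sub_nonneg.1 (ge_of_tendsto' hlim fun n => ?_)
  have hn : (0 : ℝ) < (n : ℝ) + 1 := by positivity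
  have := smul_nonneg (show (0 : ℝ) ≤ (((n : ℝ) + 1) ^ 2)⁻¹ by positivity)
    (bernstein_kadison_inequality T hT1 hT h0 h1 (n + 1))
  convert this using 1
  push_cast
  match_scalars <;> field_simp
  ring

end Kadison

/-! ### From order isomorphisms to Jordan homomorphisms -/

section Jordan

variable {A B : Type*} [CStarAlgebra A] [CStarAlgebra B]

/-- Kadison's inequality for `T` at `k` and for `T.symm` at `T k` are opposite bounds when `0 ≤ k ≤
1`; an affine change of variable reaches every self-adjoint `h`. -/
theorem map_mul_self_of_unital_order_iso [PartialOrder A] [StarOrderedRing A] [PartialOrder B]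
    [StarOrderedRing B] (T : A ≃ₗ[ℂ] B) (hT1 : T 1 = 1) (hT : ∀ a, 0 ≤ a → 0 ≤ T a)
    (hT' : ∀ b, 0 ≤ b → 0 ≤ T.symm b) {h : A} (hh : IsSelfAdjoint h) :
    T (h * h) = T h * T h := by
  have hT1' : T.symm 1 = 1 := by rw [LinearEquiv.symm_apply_eq, hT1]
  have unit_interval : ∀ k : A, 0 ≤ k → k ≤ 1 → T (k * k) = T k * T k := by
    intro k k0 k1
    refine le_antisymm ?_ (kadison_inequality T.toLinearMap hT1 hT k0 k1)
    have hk1 : T k ≤ 1 := by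
      have := hT _ (sub_nonneg.2 k1)
      rwa [map_sub, hT1, sub_nonneg] at this
    have h2 := kadison_inequality T.symm.toLinearMap hT1' hT' (hT k k0) hk1
    have h3 := hT _ (sub_nonneg.2 h2)
    simpa using h3
  -- The summand `1` allows division by `M` even when `h = 0`.
  set M : ℝ := ‖h‖ + 1 with hM
  have hMpos : 0 < M := by positivity
  have hle : h ≤ M • 1 := by
    have := hh.le_algebraMap_norm_self
    rw [Algebra.algebraMap_eq_smul_one] at this
    exact this.trans (smul_le_smul_of_nonneg_right (by simp [hM]) zero_le_one)
  have hge : 0 ≤ M • 1 + h := by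
    have := hh.neg.le_algebraMap_norm_self
    rw [Algebra.algebraMap_eq_smul_one, norm_neg] at this
    rw [← sub_neg_eq_add, sub_nonneg]
    exact this.trans (smul_le_smul_of_nonneg_right (by simp [hM]) zero_le_one)
  set k : A := (2 * M)⁻¹ • (M • 1 + h) with hk
  have hk1 : k ≤ 1 := by
    have : 1 - k = (2 * M)⁻¹ • (M • 1 - h) := by
      rw [hk]
      match_scalars <;> field_simp
      ring
    rw [← sub_nonneg, this]
    exact smul_nonneg (by positivity) (sub_nonneg.2 hle)
  have hkk := unit_interval k (smul_nonneg (by positivity) hge) hk1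
  have hhk : h = ((2 * M : ℝ) : ℂ) • k - (M : ℂ) • 1 := by
    rw [Complex.coe_smul, Complex.coe_smul, hk, smul_inv_smul₀ (by positivity)]
    abel
  rw [hhk]
  simp only [sub_mul, mul_sub, smul_mul_assoc, mul_smul_comm, one_mul, mul_one, map_sub, map_smul,
    hkk, hT1]

theorem map_star_of_map_isSelfAdjoint (T : A →ₗ[ℂ] B)
    (hT : ∀ a, IsSelfAdjoint a → IsSelfAdjoint (T a)) (x : A) : T (star x) = star (T x) := by
  have h1 := hT _ (realPart x).2
  have h2 := hT _ (imaginaryPart x).2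
  rw [← realPart_add_I_smul_imaginaryPart x]
  simp only [star_add, star_smul, map_add, map_smul, h1.star_eq, h2.star_eq,
    (realPart x).2.star_eq, (imaginaryPart x).2.star_eq]

theorem map_jordanProduct_of_map_mul_self (T : A →ₗ[ℂ] B)
    (hT : ∀ a, IsSelfAdjoint a → T (a * a) = T a * T a) (x y : A) :
    T (jordanProduct x y) = jordanProduct (T x) (T y) := by
  have hsa : ∀ a b : A, IsSelfAdjoint a → IsSelfAdjoint b →
      T (a * b) + T (b * a) = T a * T b + T b * T a := by
    intro a b ha hb
    have h := hT (a + b) (ha.add hb)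
    simp only [add_mul, mul_add, map_add, hT a ha, hT b hb] at h
    have h2 : T a * T a + (T (a * b) + T (b * a)) + T b * T b
        = T a * T a + (T a * T b + T b * T a) + T b * T b := by
      rw [← sub_eq_zero] at h ⊢
      rw [← h]
      abel
    simpa using h2
  set a := realPart x with ha
  set b := imaginaryPart x with hb
  set c := realPart y with hc
  set d := imaginaryPart y with hd
  have hx : x = a + Complex.I • (b : A) := (realPart_add_I_smul_imaginaryPart x).symm
  have hy : y = c + Complex.I • (d : A) := (realPart_add_I_smul_imaginaryPart y).symm
  have e1 := hsa a c a.2 c.2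
  have e2 := hsa a d a.2 d.2
  have e3 := hsa b c b.2 c.2
  have e4 := hsa b d b.2 d.2
  rw [jordanProduct, jordanProduct, map_smul, map_add, hx, hy]
  congr 1
  simp only [add_mul, mul_add, smul_mul_assoc, mul_smul_comm, map_add, map_smul]
  -- The four identities are combined with the coefficients `1`, `i`, `i`, `i²` of the complex
  -- bilinear expansion.
  have key := congrArg₂ (· + ·) (congrArg₂ (· + ·) e1
    (congrArg (Complex.I • ·) (congrArg₂ (· + ·) e2 e3)))
    (congrArg (Complex.I • Complex.I • ·) e4)
  simp only [smul_add] at key ⊢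
  rw [← sub_eq_zero] at key ⊢
  rw [← key]
  abel

end Jordan

/-! ### Maps preserving the numerical radius -/

section Main

variable {A B : Type*} [CStarAlgebra A] [CStarAlgebra B]

/-- A unital linear map that does not increase the numerical radius pulls states back to states. -/
theorem IsCStarState.comp_of_numericalRadius_le {T : A →ₗ[ℂ] B} (hT1 : T 1 = 1)
    (hT : ∀ x, numericalRadius (T x) ≤ numericalRadius x) {φ : B →ₗ[ℂ] ℂ}
    (hφ : IsCStarState φ) : IsCStarState (φ ∘ₗ T) :=
  isCStarState_of_norm_le (by simp [hT1, hφ.map_one]) fun x =>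
    (hφ.norm_apply_le_numericalRadius (T x)).trans ((hT x).trans (numericalRadius_le_norm x))

theorem map_nonneg_of_numericalRadius_le [PartialOrder A] [StarOrderedRing A] [PartialOrder B]
    [StarOrderedRing B] {T : A →ₗ[ℂ] B} (hT1 : T 1 = 1)
    (hT : ∀ x, numericalRadius (T x) ≤ numericalRadius x) {a : A} (ha : 0 ≤ a) : 0 ≤ T a :=
  nonneg_of_states fun _ hφ => (hφ.comp_of_numericalRadius_le hT1 hT).map_nonneg ha

end Main

theorem mainTheorem5 {A B : Type*} [CStarAlgebra A] [CStarAlgebra B] (T : A →ₗ[ℂ] B)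
    (hT_one : T 1 = 1) (hT_surj : Function.Surjective T)
    (hT_nu : ∀ x : A, numericalRadius (T x) = numericalRadius x) :
    IsJordanStarIsomorphism T := by
  let _ : PartialOrder A := CStarAlgebra.spectralOrder A
  have _ : StarOrderedRing A := CStarAlgebra.spectralOrderedRing A
  let _ : PartialOrder B := CStarAlgebra.spectralOrder B
  have _ : StarOrderedRing B := CStarAlgebra.spectralOrderedRing B
  have hinj : Function.Injective T := by
    refine (injective_iff_map_eq_zero T).2 fun x hx => eq_zero_of_numericalRadius ?_
    rw [← hT_nu, hx]
    exact le_antisymm ((numericalRadius_le_norm (0 : B)).trans norm_zero.le)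
      (Real.sSup_nonneg (by rintro r ⟨φ, -, rfl⟩; exact norm_nonneg _))
  let E : A ≃ₗ[ℂ] B := LinearEquiv.ofBijective T ⟨hinj, hT_surj⟩
  have hE1 : E.symm 1 = 1 := by
    rw [LinearEquiv.symm_apply_eq]
    exact hT_one.symm
  have hE : ∀ y, numericalRadius (E.symm y) = numericalRadius y := by
    intro y
    rw [← hT_nu]
    congr 1
    exact E.apply_symm_apply y
  refine ⟨⟨hinj, hT_surj⟩, map_jordanProduct_of_map_mul_self T fun a ha => ?_,
    map_star_of_map_isSelfAdjoint T fun a ha => ?_⟩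
  · exact map_mul_self_of_unital_order_iso E hT_one
      (fun a ha => map_nonneg_of_numericalRadius_le hT_one (fun x => (hT_nu x).le) ha)
      (fun b hb => map_nonneg_of_numericalRadius_le (T := E.symm.toLinearMap) hE1
        (fun y => (hE y).le) hb) ha
  · exact isSelfAdjoint_of_states fun φ hφ =>
      (hφ.comp_of_numericalRadius_le hT_one fun x => (hT_nu x).le).im_eq_zero ha
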